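/- Let $0<\nu<1$. For $\lambda>-1$, $\mu,z\in\mathbb C$ let $$W_{\lambda,\mu}(z)=\sum_{n=0}^{\infty}\frac{z^n}{n!\,\Gamma(\lambda n+\mu)}$$ be the Wright function, and for $\operatorname{Re}\alpha>0$, $\beta,z\in\mathbb C$ let $$E_{\alpha,\beta}(z)=\sum_{n=0}^{\infty}\frac{z^n}{\Gamma(\alpha n+\beta)},\qquad E_\alpha(z)=\sum_{n=0}^{\infty}\frac{z^n}{\Gamma(\alpha n+1)}$$ be the Mittag-Leffler functions, where $1/\Gamma$ is read as $0$ at the poles of $\Gamma$. Let $M_\nu(z)=W_{-\nu,1-\nu}(-z)$. (a) For every $\mu\in\mathbb C$ with $\operatorname{Re}\mu>0$ and every $s\in\mathbb C$, the following integral converges absolutely and $$\int_0^\infty e^{-sr}\,W_{-\nu,\mu}(-r)\,dr=E_{\nu,\mu+\nu}(-s).$$ (b) In particular, for every $s\in\mathbb C$, the following integral converges absolutely and $$\int_0^\infty e^{-sr}\,M_\nu(r)\,dr=E_\nu(-s).$$ -/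

import Mathlib

noncomputable section

namespace WrightLaplace

/-- The Wright function `W_{l,μ}(z) = ∑_{n ≥ 0} z ^ n / (n! Γ(l n + μ))`, for real `l > -1` and
complex `μ`, `z`. Mathlib's `Complex.Gamma` takes the value `0` at its poles and `0⁻¹ = 0`, so
`(Complex.Gamma w)⁻¹` is the entire function `1 / Γ` at every `w`. -/
def wright (l : ℝ) (μ z : ℂ) : ℂ :=
  ∑' n : ℕ, z ^ n * ((n.factorial : ℂ) * Complex.Gamma ((l : ℂ) * (n : ℂ) + μ))⁻¹

/-- The two-parameter Mittag-Leffler function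
`E_{α,β}(z) = ∑_{n ≥ 0} z ^ n / Γ(α n + β)`, for `Re α > 0` and complex `β`, `z`. -/
def mittagLefflerTwo (α β z : ℂ) : ℂ :=
  ∑' n : ℕ, z ^ n * (Complex.Gamma (α * (n : ℂ) + β))⁻¹

/-- The classical Mittag-Leffler function `E_α(z) = ∑_{n ≥ 0} z ^ n / Γ(α n + 1)`. -/
def mittagLeffler (α z : ℂ) : ℂ :=
  ∑' n : ℕ, z ^ n * (Complex.Gamma (α * (n : ℂ) + 1))⁻¹

/-- The `M`-Wright function `M_ν(z) = W_{-ν,1-ν}(-z)`, for `0 < ν < 1`. -/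
def mWright (ν : ℝ) (z : ℂ) : ℂ :=
  wright (-ν) (1 - (ν : ℂ)) (-z)

/-- `f` has the Laplace transform `F` at `s`: the integral `∫_0^∞ e^{-s r} f(r) dr` converges
absolutely and its value is `F`. -/
def HasLaplaceAt (f : ℝ → ℂ) (s F : ℂ) : Prop :=
  MeasureTheory.IntegrableOn (fun r : ℝ => Complex.exp (-s * (r : ℂ)) * f r) (Set.Ioi 0) ∧
    ∫ r in Set.Ioi (0 : ℝ), Complex.exp (-s * (r : ℂ)) * f r = F

end WrightLaplace

end

/-!
The proof represents the Wright function and the Mittag-Leffler function as integrals along one and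
the same contour, and obtains the Laplace transform by exchanging two integrals.

The contour is a wedge `t(y) = c - η |y| + i y` with apex `c > 0` and slope `0 < η < 1`. It lies in
the slit plane, and `|e ^ t|` decays exponentially along it. Hankel's formula
`1 / Γ(w) = (2 π i)⁻¹ ∫ e ^ t t ^ (-w) dt` holds on it for every complex `w`
(`rayIntegral_sub_rayIntegral`). For `Re w > 2` it follows from Fourier inversion of
`x ^ (w - 1) e ^ (-c x)`, which gives the same formula on the vertical line through `c`
(`integral_vertical_exp_mul_cpow_neg`), and from tilting the two half-lines
(`integral_ray_tilt`); integration by parts shows that both sides satisfy the recursion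
`f(w) = w f(w + 1)`, which extends the formula to all `w`.

Since `ν < 1`, the decay of `e ^ t` permits inserting Hankel's formula in the series of the Wright
function term by term, and `W_{-ν,μ}(-r) = (2 π i)⁻¹ ∫ e ^ (t - r t ^ ν) t ^ (-μ) dt`
(`wright_neg_eq_integral`). Choose the slope so small that the arguments on the wedge stay below
some `φ` with `ν φ < π / 2`, and the apex so far to the right that `Re (t ^ ν) ≥ ‖s‖ + 1` on it
(`cos_mul_rpow_le_re_wedge_cpow`). Then `e ^ (-s r) e ^ (-r t ^ ν)` is bounded by `e ^ (-r)`,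
Fubini's theorem applies, and the Laplace transform equals
`(2 π i)⁻¹ ∫ e ^ t t ^ (-μ) (s + t ^ ν)⁻¹ dt`. The geometric series of `(s + t ^ ν)⁻¹` and Hankel's
formula turn this into the series of `E_{ν,μ+ν}(-s)` (`integral_div_eq_mittagLefflerTwo`). The
argument puts no condition on `μ`.
-/

namespace WrightLaplace
open MeasureTheory Set Filter Topology

/-! ### Rays from a point of the positive half-line -/

/-- The point `c + ρ (σ i - η)` at parameter `ρ ≥ 0` of the ray that leaves the real point `c` in
the direction `σ i - η`. For `σ = ± 1` and small `η > 0` the ray leans slightly to the left of the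
vertical. -/
def rayPoint (c σ η ρ : ℝ) : ℂ := c + ρ * (σ * Complex.I - η)

theorem rayPoint_re (c σ η ρ : ℝ) : (rayPoint c σ η ρ).re = c - ρ * η := by
  simp [rayPoint]; ring

theorem rayPoint_im (c σ η ρ : ℝ) : (rayPoint c σ η ρ).im = ρ * σ := by
  simp [rayPoint]

theorem rayPoint_mem_slitPlane {c σ η ρ : ℝ} (hc : 0 < c) (hσ : |σ| = 1) (hρ : 0 ≤ ρ) :
    rayPoint c σ η ρ ∈ Complex.slitPlane := by
  rw [Complex.mem_slitPlane_iff, rayPoint_re, rayPoint_im]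
  rcases hρ.eq_or_lt with h | h
  · left; simp [← h, hc]
  · right
    have : σ ≠ 0 := by rintro rfl; simp at hσ
    positivity

theorem le_norm_rayPoint {c σ η ρ : ℝ} (hσ : |σ| = 1) (hρ : 0 ≤ ρ) :
    ρ ≤ ‖rayPoint c σ η ρ‖ := by
  have h := Complex.abs_im_le_norm (rayPoint c σ η ρ)
  rwa [rayPoint_im, abs_mul, hσ, mul_one, abs_of_nonneg hρ] at h

theorem half_le_norm_rayPoint {c σ η ρ : ℝ} (hσ : |σ| = 1) (hη1 : η ≤ 1)
    (hρ : 0 ≤ ρ) : c / 2 ≤ ‖rayPoint c σ η ρ‖ := by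
  rcases le_total (c / 2) ρ with h | h
  · exact h.trans (le_norm_rayPoint hσ hρ)
  · refine le_trans ?_ (Complex.re_le_norm _)
    rw [rayPoint_re]
    nlinarith

theorem norm_rayPoint_le {c σ η ρ : ℝ} (hc : 0 < c) (hσ : |σ| = 1) (hη : 0 ≤ η) (hη1 : η ≤ 1)
    (hρ : 0 ≤ ρ) : ‖rayPoint c σ η ρ‖ ≤ c + 2 * ρ := by
  refine (Complex.norm_le_abs_re_add_abs_im _).trans ?_
  rw [rayPoint_re, rayPoint_im, abs_mul, hσ, abs_of_nonneg hρ]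
  have : |c - ρ * η| ≤ c + ρ := by
    rw [abs_le]; constructor <;> nlinarith [mul_nonneg hρ hη]
  linarith

theorem norm_rayPoint_rpow_neg_le {c σ η ρ p : ℝ} (hc : 0 < c) (hσ : |σ| = 1)
    (hη1 : η ≤ 1) (hρ : 0 ≤ ρ) (hp : 0 ≤ p) :
    ‖rayPoint c σ η ρ‖ ^ (-p) ≤ (c / 2 / (1 + c / 2)) ^ (-p) * (1 + ρ) ^ (-p) := by
  rw [← Real.mul_rpow (by positivity) (by positivity)]
  refine Real.rpow_le_rpow_of_nonpos (by positivity) ?_ (by linarith)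
  rw [div_mul_eq_mul_div, div_le_iff₀ (by positivity)]
  have h1 := le_norm_rayPoint (c := c) (η := η) hσ hρ
  have h2 := half_le_norm_rayPoint (c := c) hσ hη1 hρ
  nlinarith

theorem hasDerivAt_rayPoint (c σ η ρ : ℝ) :
    HasDerivAt (rayPoint c σ η) (σ * Complex.I - η) ρ := by
  change HasDerivAt (fun ρ : ℝ => (c : ℂ) + ρ * (σ * Complex.I - η)) _ _
  simpa using
    ((Complex.ofRealCLM.hasDerivAt (x := ρ)).mul_const ((σ : ℂ) * Complex.I - η)).const_add (c : ℂ)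

theorem hasDerivAt_rayPoint_slope (c σ η ρ : ℝ) :
    HasDerivAt (fun η : ℝ => rayPoint c σ η ρ) (-(ρ : ℂ)) η := by
  simpa [rayPoint] using
    (((Complex.ofRealCLM.hasDerivAt (x := η)).const_sub ((σ : ℂ) * Complex.I)).const_mul
      (ρ : ℂ)).const_add (c : ℂ)

theorem continuous_rayPoint (c σ η : ℝ) : Continuous (rayPoint c σ η) := by
  unfold rayPoint; fun_prop

theorem integrableOn_one_add_rpow {q : ℝ} (hq : 1 < q) :
    IntegrableOn (fun ρ : ℝ => (1 + ρ) ^ (-q)) (Ioi 0) := by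
  have := integrableOn_add_rpow_Ioi_of_lt (a := -q) (c := 0) (m := 1) (by linarith) (by norm_num)
  simpa [add_comm] using this

/-- The integral of `F` along a ray does not change when the ray is tilted, provided `F` and `F'`
decay like `‖t‖ ^ (-p)` with `p > 2`. The derivative of the integrand with respect to the slope
`η` is the exact derivative `-d/dρ (ρ F (c + ρ (σ i - η)))`, so that its integral vanishes. -/
theorem integral_ray_tilt {F F' : ℂ → ℂ} {c p C σ η : ℝ} (hc : 0 < c) (hp : 2 < p)
    (hσ : |σ| = 1) (hη : 0 ≤ η) (hη1 : η < 1)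
    (hF : ∀ t ∈ Complex.slitPlane, HasDerivAt F (F' t) t) (hF' : ContinuousOn F' Complex.slitPlane)
    (hb : ∀ t ∈ Complex.slitPlane, t.re ≤ c → c / 2 ≤ ‖t‖ → ‖F t‖ ≤ C * ‖t‖ ^ (-p))
    (hb' : ∀ t ∈ Complex.slitPlane, t.re ≤ c → c / 2 ≤ ‖t‖ → ‖F' t‖ ≤ C * ‖t‖ ^ (-p)) :
    ∫ ρ in Ioi (0 : ℝ), (σ * Complex.I - η) * F (rayPoint c σ η ρ) =
      ∫ ρ in Ioi (0 : ℝ), (σ * Complex.I) * F (rayPoint c σ 0 ρ) := by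
  set κ : ℝ := (c / 2 / (1 + c / 2)) ^ (-p)
  have hκ0 : 0 < κ := by positivity
  have hre : ∀ {a ρ : ℝ}, 0 ≤ a → 0 ≤ ρ → (rayPoint c σ a ρ).re ≤ c := fun ha hρ => by
    rw [rayPoint_re]; nlinarith [mul_nonneg hρ ha]
  have hC : 0 ≤ C := by
    have h := (norm_nonneg _).trans (hb (c : ℂ) (by simp [hc]) (by simp)
      (by simp [abs_of_pos hc, hc.le]))
    have : 0 < ‖(c : ℂ)‖ ^ (-p) := by
      apply Real.rpow_pos_of_pos; simp [hc.ne']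
    exact nonneg_of_mul_nonneg_left h this
  have bd : ∀ {G : ℂ → ℂ}, (∀ t ∈ Complex.slitPlane, t.re ≤ c → c / 2 ≤ ‖t‖ →
      ‖G t‖ ≤ C * ‖t‖ ^ (-p)) → ∀ {a ρ : ℝ}, 0 ≤ a → a ≤ 1 → 0 ≤ ρ →
      ‖G (rayPoint c σ a ρ)‖ ≤ C * κ * (1 + ρ) ^ (-p) := by
    intro G hG a ρ ha ha1 hρ
    refine (hG _ (rayPoint_mem_slitPlane hc hσ hρ) (hre ha hρ)
      (half_le_norm_rayPoint hσ ha1 hρ)).trans ?_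
    rw [mul_assoc]
    exact mul_le_mul_of_nonneg_left (norm_rayPoint_rpow_neg_le hc hσ ha1 hρ (by linarith)) hC
  have hd : ∀ {a : ℝ}, 0 ≤ a → a ≤ 1 → ‖(σ : ℂ) * Complex.I - a‖ ≤ 2 := by
    intro a ha ha1
    refine (norm_sub_le _ _).trans ?_
    simp only [norm_mul, Complex.norm_real, Complex.norm_I, Real.norm_eq_abs, hσ, abs_of_nonneg ha]
    linarith
  have hFc : ContinuousOn F Complex.slitPlane := fun t ht =>
    (hF t ht).continuousAt.continuousWithinAt
  have hray : ∀ {G : ℂ → ℂ}, ContinuousOn G Complex.slitPlane → ∀ a : ℝ,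
      ContinuousOn (fun ρ => G (rayPoint c σ a ρ)) (Ici 0) := fun hG a =>
    hG.comp (continuous_rayPoint c σ a).continuousOn
      (fun ρ hρ => rayPoint_mem_slitPlane hc hσ hρ)
  have hmeas : ∀ {G : ℝ → ℂ}, ContinuousOn G (Ici 0) →
      AEStronglyMeasurable G (volume.restrict (Ioi (0 : ℝ))) := fun hG =>
    (hG.mono Ioi_subset_Ici_self).aestronglyMeasurable measurableSet_Ioi
  have hpow : ∀ {ρ : ℝ}, 0 ≤ ρ → ρ * (1 + ρ) ^ (-p) ≤ (1 + ρ) ^ (-(p - 1)) := by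
    intro ρ hρ
    have h : (1 + ρ) ^ (-(p - 1)) = (1 + ρ) * (1 + ρ) ^ (-p) := by
      rw [show -(p - 1) = 1 + -p by ring, Real.rpow_add (by positivity), Real.rpow_one]
    rw [h]
    exact mul_le_mul_of_nonneg_right (by linarith) (by positivity)
  have hpow' : ∀ {ρ : ℝ}, 0 ≤ ρ → (1 + ρ) ^ (-p) ≤ (1 + ρ) ^ (-(p - 1)) := by
    intro ρ hρ
    exact Real.rpow_le_rpow_of_exponent_le (by linarith) (by linarith)
  set J : ℝ → ℂ := fun a => ∫ ρ in Ioi (0 : ℝ), (σ * Complex.I - a) * F (rayPoint c σ a ρ) with hJ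
  -- The bound on the integrand is uniform in the slope.
  have hbF : ∀ {a ρ : ℝ}, 0 ≤ a → a ≤ 1 → 0 ≤ ρ →
      ‖((σ : ℂ) * Complex.I - a) * F (rayPoint c σ a ρ)‖ ≤
        2 * (C * κ) * (1 + ρ) ^ (-(p - 1)) := by
    intro a ρ ha ha1 hρ
    rw [norm_mul, mul_assoc 2]
    refine mul_le_mul (hd ha ha1) ((bd hb ha ha1 hρ).trans ?_) (norm_nonneg _) (by norm_num)
    exact mul_le_mul_of_nonneg_left (hpow' hρ) (by positivity)
  have hbint : ∀ K : ℝ, IntegrableOn (fun ρ : ℝ => K * (1 + ρ) ^ (-(p - 1))) (Ioi 0) := fun K =>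
    (integrableOn_one_add_rpow (by linarith)).const_mul K
  have hJc : ContinuousOn J (Icc 0 1) := by
    refine continuousOn_of_dominated (bound := fun ρ => 2 * (C * κ) * (1 + ρ) ^ (-(p - 1)))
      (fun a _ => hmeas (continuousOn_const.mul (hray hFc a))) (fun a ha => ?_) (hbint _) ?_
    · filter_upwards [ae_restrict_mem measurableSet_Ioi] with ρ hρ
      exact hbF ha.1 ha.2 (le_of_lt hρ)
    · filter_upwards [ae_restrict_mem measurableSet_Ioi] with ρ hρ
      refine ContinuousOn.mul (by fun_prop) ?_
      refine hFc.comp (fun a _ => ?_) (fun a _ => rayPoint_mem_slitPlane hc hσ (le_of_lt hρ))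
      exact (hasDerivAt_rayPoint_slope c σ a ρ).continuousAt.continuousWithinAt
  have hJd : ∀ a ∈ Ioo (0 : ℝ) 1, HasDerivAt J 0 a := by
    intro a ha
    have hbd : ∀ {x ρ : ℝ}, x ∈ Ioo (0 : ℝ) 1 → 0 ≤ ρ →
        ‖-(F (rayPoint c σ x ρ) + ρ * (((σ : ℂ) * Complex.I - x) * F' (rayPoint c σ x ρ)))‖ ≤
          3 * (C * κ) * (1 + ρ) ^ (-(p - 1)) := by
      intro x ρ hx hρ
      rw [norm_neg]
      refine (norm_add_le _ _).trans ?_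
      have h1 := (bd hb hx.1.le hx.2.le hρ).trans
        (mul_le_mul_of_nonneg_left (hpow' hρ) (by positivity))
      have h2 : ‖(ρ : ℂ) * (((σ : ℂ) * Complex.I - x) * F' (rayPoint c σ x ρ))‖ ≤
          2 * (C * κ) * (1 + ρ) ^ (-(p - 1)) := by
        rw [norm_mul, norm_mul, Complex.norm_real, Real.norm_of_nonneg hρ]
        calc ρ * (‖(σ : ℂ) * Complex.I - x‖ * ‖F' (rayPoint c σ x ρ)‖)
            ≤ ρ * (2 * (C * κ * (1 + ρ) ^ (-p))) := by
              gcongr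
              · exact hd hx.1.le hx.2.le
              · exact bd hb' hx.1.le hx.2.le hρ
          _ = 2 * (C * κ) * (ρ * (1 + ρ) ^ (-p)) := by ring
          _ ≤ _ := mul_le_mul_of_nonneg_left (hpow hρ) (by positivity)
      linarith
    have hcontF' : ContinuousOn (fun ρ : ℝ => -(F (rayPoint c σ a ρ) +
        ρ * (((σ : ℂ) * Complex.I - a) * F' (rayPoint c σ a ρ)))) (Ici 0) :=
      ((hray hFc a).add ((by fun_prop : ContinuousOn (fun ρ : ℝ => (ρ : ℂ)) (Ici 0)).mul
        (continuousOn_const.mul (hray hF' a)))).neg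
    have key := hasDerivAt_integral_of_dominated_loc_of_deriv_le
      (μ := volume.restrict (Ioi (0 : ℝ)))
      (F := fun (x ρ : ℝ) => ((σ : ℂ) * Complex.I - x) * F (rayPoint c σ x ρ))
      (F' := fun (x ρ : ℝ) =>
        -(F (rayPoint c σ x ρ) + ρ * (((σ : ℂ) * Complex.I - x) * F' (rayPoint c σ x ρ))))
      (bound := fun ρ => 3 * (C * κ) * (1 + ρ) ^ (-(p - 1)))
      (Ioo_mem_nhds ha.1 ha.2)
      (Eventually.of_forall fun x => hmeas (continuousOn_const.mul (hray hFc x)))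
      ((hbint (2 * (C * κ))).mono' (hmeas (continuousOn_const.mul (hray hFc a))) (by
        filter_upwards [ae_restrict_mem measurableSet_Ioi] with ρ hρ
        exact hbF ha.1.le ha.2.le (le_of_lt hρ)))
      (hmeas hcontF')
      (by
        filter_upwards [ae_restrict_mem measurableSet_Ioi] with ρ hρ x hx
        exact hbd hx (le_of_lt hρ))
      (hbint _)
      (by
        filter_upwards [ae_restrict_mem measurableSet_Ioi] with ρ hρ x hx
        have h1 : HasDerivAt (fun x : ℝ => (σ : ℂ) * Complex.I - x) (-1) x := by
          simpa using (Complex.ofRealCLM.hasDerivAt (x := x)).const_sub ((σ : ℂ) * Complex.I)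
        have h2 := (hF _ (rayPoint_mem_slitPlane hc hσ (le_of_lt hρ))).comp x
          (hasDerivAt_rayPoint_slope c σ x ρ)
        refine (h1.mul h2).congr_deriv ?_
        simp only [Function.comp_apply]
        ring)
    -- The integrand is the derivative of `-ρ F`, which vanishes at `0` and at infinity.
    have hzero : ∫ ρ in Ioi (0 : ℝ), -(F (rayPoint c σ a ρ) +
        ρ * (((σ : ℂ) * Complex.I - a) * F' (rayPoint c σ a ρ))) = 0 := by
      have := integral_Ioi_of_hasDerivAt_of_tendsto (a := (0 : ℝ)) (m := 0)
        (f := fun ρ : ℝ => -((ρ : ℂ) * F (rayPoint c σ a ρ)))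
        (f' := fun ρ : ℝ => -(F (rayPoint c σ a ρ) +
          ρ * (((σ : ℂ) * Complex.I - a) * F' (rayPoint c σ a ρ))))
        (((by fun_prop : ContinuousOn (fun ρ : ℝ => (ρ : ℂ)) (Ici 0)).mul
          (hray hFc a)).neg 0 self_mem_Ici)
        (fun ρ hρ => by
          have h1 : HasDerivAt (fun ρ : ℝ => (ρ : ℂ)) 1 ρ := Complex.ofRealCLM.hasDerivAt
          have h2 := (hF _ (rayPoint_mem_slitPlane (η := a) hc hσ (le_of_lt hρ))).comp ρ
            (hasDerivAt_rayPoint c σ a ρ)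
          refine (h1.mul h2).neg.congr_deriv ?_
          simp only [Function.comp_apply]
          ring)
        key.1 (by
          have hlim : Tendsto (fun ρ : ℝ => C * κ * (1 + ρ) ^ (-(p - 1))) atTop (𝓝 0) := by
            have := ((tendsto_rpow_neg_atTop (y := p - 1) (by linarith)).comp
              (tendsto_atTop_add_const_left atTop (1 : ℝ) tendsto_id)).const_mul (C * κ)
            simpa using this
          refine squeeze_zero_norm' ?_ hlim
          filter_upwards [eventually_ge_atTop (0 : ℝ)] with ρ hρ
          rw [norm_neg, norm_mul, Complex.norm_real, Real.norm_of_nonneg hρ]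
          calc ρ * ‖F (rayPoint c σ a ρ)‖ ≤ ρ * (C * κ * (1 + ρ) ^ (-p)) := by
                gcongr; exact bd hb ha.1.le ha.2.le hρ
            _ = C * κ * (ρ * (1 + ρ) ^ (-p)) := by ring
            _ ≤ _ := mul_le_mul_of_nonneg_left (hpow hρ) (by positivity))
      simpa using this
    have h := key.2
    rw [hzero] at h
    exact h
  rcases hη.eq_or_lt with rfl | hη0
  · simp
  -- The derivative is two-sided only for slopes in the open interval, so the vertical ray is
  -- reached as a limit.
  have hconst : ∀ ε ∈ Ioc 0 η, J ε = J η := by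
    intro ε hε
    refine (constant_of_has_deriv_right_zero (a := ε) (b := η)
      (hJc.mono (Icc_subset_Icc hε.1.le hη1.le))
      (fun x hx => (hJd x ⟨hε.1.trans_le hx.1, hx.2.trans hη1⟩).hasDerivWithinAt) η
      ⟨hε.2, le_rfl⟩).symm
  have hlim0 : Tendsto J (𝓝[Ioc 0 η] 0) (𝓝 (J 0)) :=
    (hJc 0 ⟨le_rfl, zero_le_one⟩).mono_left
      (nhdsWithin_mono _ fun x hx => ⟨hx.1.le, hx.2.trans hη1.le⟩)
  have hlim1 : Tendsto J (𝓝[Ioc 0 η] 0) (𝓝 (J η)) :=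
    tendsto_const_nhds.congr' (by
      filter_upwards [self_mem_nhdsWithin] with ε hε using (hconst ε hε).symm)
  have : (𝓝[Ioc 0 η] (0 : ℝ)).NeBot := by
    rw [nhdsWithin_Ioc_eq_nhdsGT hη0]; infer_instance
  have := tendsto_nhds_unique hlim1 hlim0
  simpa [hJ] using this

/-! ### The Laplace transform of a power -/

theorem norm_cpow_mul_exp_neg_mul {a z : ℂ} {x : ℝ} (hx : 0 < x) :
    ‖(x : ℂ) ^ a * Complex.exp (-(z * x))‖ = x ^ a.re * Real.exp (-(z.re * x)) := by
  rw [norm_mul, Complex.norm_cpow_eq_rpow_re_of_pos hx, Complex.norm_exp]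
  simp

theorem integrableOn_rpow_mul_exp_neg_mul {a b : ℝ} (ha : -1 < a) (hb : 0 < b) :
    IntegrableOn (fun x : ℝ => x ^ a * Real.exp (-(b * x))) (Ioi 0) := by
  have := integrableOn_rpow_mul_exp_neg_mul_rpow (p := 1) (s := a) (b := b) ha one_pos hb
  simpa using this

theorem aestronglyMeasurable_cpow_mul_exp_neg_mul (a z : ℂ) :
    AEStronglyMeasurable (fun x : ℝ => (x : ℂ) ^ a * Complex.exp (-(z * x)))
      (volume.restrict (Ioi 0)) := by
  refine ContinuousOn.aestronglyMeasurable (fun x hx => ?_) measurableSet_Ioi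
  refine ContinuousAt.continuousWithinAt (ContinuousAt.mul ?_ (by fun_prop))
  exact Complex.continuousAt_ofReal_cpow_const _ _ (Or.inr (ne_of_gt hx))

theorem integrableOn_cpow_mul_exp_neg_mul {a z : ℂ} (ha : -1 < a.re) (hz : 0 < z.re) :
    IntegrableOn (fun x : ℝ => (x : ℂ) ^ a * Complex.exp (-(z * x))) (Ioi 0) := by
  refine (integrableOn_rpow_mul_exp_neg_mul ha hz).mono'
    (aestronglyMeasurable_cpow_mul_exp_neg_mul a z) ?_
  filter_upwards [ae_restrict_mem measurableSet_Ioi] with x hx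
  exact (norm_cpow_mul_exp_neg_mul hx).le

theorem differentiableAt_integral_cpow_mul_exp_neg_mul {a z : ℂ} (ha : -1 < a.re)
    (hz : 0 < z.re) :
    DifferentiableAt ℂ
      (fun z : ℂ => ∫ x in Ioi (0 : ℝ), (x : ℂ) ^ a * Complex.exp (-(z * x))) z := by
  have hs : {y : ℂ | z.re / 2 < y.re} ∈ 𝓝 z :=
    (isOpen_lt continuous_const Complex.continuous_re).mem_nhds (by simpa using by linarith)
  have key := hasDerivAt_integral_of_dominated_loc_of_deriv_le
    (μ := volume.restrict (Ioi (0 : ℝ)))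
    (F := fun (z : ℂ) (x : ℝ) => (x : ℂ) ^ a * Complex.exp (-(z * x)))
    (F' := fun (z : ℂ) (x : ℝ) => -((x : ℂ) ^ (a + 1) * Complex.exp (-(z * x))))
    (bound := fun x => x ^ (a + 1).re * Real.exp (-(z.re / 2 * x)))
    hs (Eventually.of_forall fun y => aestronglyMeasurable_cpow_mul_exp_neg_mul a y)
    (integrableOn_cpow_mul_exp_neg_mul ha hz)
    (aestronglyMeasurable_cpow_mul_exp_neg_mul (a + 1) z).neg
    (by
      filter_upwards [ae_restrict_mem measurableSet_Ioi] with x hx y hy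
      rw [norm_neg, norm_cpow_mul_exp_neg_mul hx]
      have hx0 : (0 : ℝ) < x := hx
      have hy0 : z.re / 2 < y.re := hy
      gcongr)
    (integrableOn_rpow_mul_exp_neg_mul (by simp; linarith) (by linarith))
    (by
      filter_upwards [ae_restrict_mem measurableSet_Ioi] with x hx y hy
      have hx0 : (x : ℂ) ≠ 0 := by exact_mod_cast (ne_of_gt hx)
      have h1 : HasDerivAt (fun y : ℂ => -(y * x)) (-(x : ℂ)) y :=
        (hasDerivAt_mul_const (x : ℂ)).fun_neg
      refine (h1.cexp.const_mul ((x : ℂ) ^ a)).congr_deriv ?_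
      rw [Complex.cpow_add _ _ hx0, Complex.cpow_one]
      ring)
  exact key.2.differentiableAt

/-- Mathlib has this formula for real `z > 0`; both sides are holomorphic for `Re z > 0`. -/
theorem integral_cpow_mul_exp_neg_mul_of_re_pos {a z : ℂ} (ha : 0 < a.re) (hz : 0 < z.re) :
    ∫ x in Ioi (0 : ℝ), (x : ℂ) ^ (a - 1) * Complex.exp (-(z * x)) =
      z ^ (-a) * Complex.Gamma a := by
  have hopen : IsOpen {z : ℂ | 0 < z.re} := isOpen_lt continuous_const Complex.continuous_re
  have hf : AnalyticOnNhd ℂ (fun z : ℂ => ∫ x in Ioi (0 : ℝ),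
      (x : ℂ) ^ (a - 1) * Complex.exp (-(z * x))) {z : ℂ | 0 < z.re} :=
    DifferentiableOn.analyticOnNhd (fun y hy =>
      (differentiableAt_integral_cpow_mul_exp_neg_mul (by simpa using ha)
        hy).differentiableWithinAt) hopen
  have hg : AnalyticOnNhd ℂ (fun z : ℂ => z ^ (-a) * Complex.Gamma a) {z : ℂ | 0 < z.re} :=
    DifferentiableOn.analyticOnNhd (fun y hy =>
      ((differentiableAt_id.cpow_const (Or.inl hy)).mul_const _).differentiableWithinAt) hopen
  refine hf.eqOn_of_preconnected_of_frequently_eq hg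
    ((convex_halfSpace_re_gt 0).isPreconnected) (z₀ := 1) (by simp) ?_ hz
  have hlim : Tendsto (fun n : ℕ => (((1 : ℝ) + 1 / ((n : ℝ) + 1) : ℝ) : ℂ)) atTop
      (𝓝[≠] (1 : ℂ)) := by
    refine tendsto_nhdsWithin_iff.2 ⟨?_, Eventually.of_forall fun n => ?_⟩
    · have := (tendsto_one_div_add_atTop_nhds_zero_nat (𝕜 := ℝ)).const_add 1
      simpa [Function.comp_def] using (Complex.continuous_ofReal.tendsto _).comp this
    · have : (0 : ℝ) < 1 / ((n : ℝ) + 1) := by positivity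
      simp only [mem_compl_iff, mem_singleton_iff]
      exact_mod_cast (by linarith : (1 : ℝ) < 1 + 1 / ((n : ℝ) + 1)).ne'
  refine hlim.frequently (Frequently.of_forall fun n => ?_)
  have hr : (0 : ℝ) < 1 + 1 / ((n : ℝ) + 1) := by positivity
  rw [Complex.integral_cpow_mul_exp_neg_mul_Ioi ha hr, one_div, Complex.inv_cpow,
    ← Complex.cpow_neg]
  rw [Complex.arg_ofReal_of_nonneg hr.le]
  exact Real.pi_pos.ne

/-! ### The reciprocal Gamma function as an integral along a vertical line -/

theorem norm_vertical_rpow_neg_le {c p : ℝ} (hc : 0 < c) (hp : 0 ≤ p) (y : ℝ) :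
    ‖(c : ℂ) + y * Complex.I‖ ^ (-p) ≤ (c / 2 / (1 + c / 2)) ^ (-p) * (1 + ‖y‖) ^ (-p) := by
  rcases le_total 0 y with h | h
  · have := norm_rayPoint_rpow_neg_le (σ := 1) (η := 0) hc (by simp) zero_le_one h hp
    simpa [rayPoint, abs_of_nonneg h] using this
  · have := norm_rayPoint_rpow_neg_le (σ := -1) (η := 0) hc (by simp) zero_le_one
      (neg_nonneg.2 h) hp
    simpa [rayPoint, abs_of_nonpos h] using this

theorem norm_cpow_neg_le (t w : ℂ) :
    ‖t ^ (-w)‖ ≤ Real.exp (Real.pi * |w.im|) * ‖t‖ ^ (-w.re) := by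
  refine (Complex.norm_cpow_le t (-w)).trans ?_
  rw [div_eq_mul_inv, ← Real.exp_neg, mul_comm, Complex.neg_re]
  gcongr
  calc -(t.arg * (-w).im) = t.arg * w.im := by simp
    _ ≤ |t.arg| * |w.im| := (le_abs_self _).trans (abs_mul _ _).le
    _ ≤ _ := by gcongr; exact Complex.abs_arg_le_pi t

theorem continuous_vertical_cpow {c : ℝ} (hc : 0 < c) (w : ℂ) :
    Continuous (fun y : ℝ => ((c : ℂ) + y * Complex.I) ^ w) := by
  refine Continuous.cpow (by fun_prop) continuous_const (fun y => Or.inl ?_)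
  simpa using hc

theorem integrable_vertical_cpow_neg {c : ℝ} (hc : 0 < c) {w : ℂ} (hw : 1 < w.re) :
    Integrable (fun y : ℝ => ((c : ℂ) + y * Complex.I) ^ (-w)) := by
  refine ((integrable_one_add_norm (E := ℝ) (μ := volume) (r := w.re) (by simpa using hw)).const_mul
    (Real.exp (Real.pi * |w.im|) * (c / 2 / (1 + c / 2)) ^ (-w.re))).mono'
    (continuous_vertical_cpow hc _).aestronglyMeasurable (Eventually.of_forall fun y => ?_)
  refine (norm_cpow_neg_le _ _).trans ?_
  rw [mul_assoc]
  gcongr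
  exact norm_vertical_rpow_neg_le hc (by linarith) y

/-- Fourier inversion, at the point `1`, of `x ↦ x ^ (w - 1) e ^ (-c x)` on the positive
half-line. -/
theorem integral_vertical_exp_mul_cpow_neg {c : ℝ} (hc : 0 < c) {w : ℂ} (hw : 1 < w.re) :
    ∫ y : ℝ, Complex.exp (c + y * Complex.I) * ((c : ℂ) + y * Complex.I) ^ (-w) =
      2 * Real.pi * (Complex.Gamma w)⁻¹ := by
  have hG : Complex.Gamma w ≠ 0 := Complex.Gamma_ne_zero_of_re_pos (by linarith)
  set f : ℝ → ℂ :=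
    (Ioi (0 : ℝ)).indicator (fun x : ℝ => (x : ℂ) ^ (w - 1) * Complex.exp (-(c * x))) with hf
  have hfi : Integrable f := by
    rw [hf, integrable_indicator_iff measurableSet_Ioi]
    exact integrableOn_cpow_mul_exp_neg_mul (by simp; linarith) (by simpa using hc)
  have hfour : ∀ ξ : ℝ, FourierTransform.fourier f ξ =
      ((c : ℂ) + ((2 * Real.pi * ξ : ℝ) : ℂ) * Complex.I) ^ (-w) * Complex.Gamma w := by
    intro ξ
    rw [Real.fourier_real_eq_integral_exp_smul,
      ← integral_cpow_mul_exp_neg_mul_of_re_pos (by linarith) (by simpa using hc),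
      ← integral_indicator measurableSet_Ioi]
    refine integral_congr_ae (Eventually.of_forall fun x => ?_)
    by_cases hx : x ∈ Ioi (0 : ℝ)
    · simp only [hf, indicator_of_mem hx, smul_eq_mul]
      rw [mul_left_comm, ← Complex.exp_add]
      congr 2
      push_cast
      ring
    · simp [hf, indicator_of_notMem hx]
  have hpi : (2 * Real.pi) ≠ 0 := by positivity
  have hFi : Integrable (FourierTransform.fourier f) := by
    have h := ((integrable_vertical_cpow_neg hc hw).comp_mul_left' hpi).mul_const
      (Complex.Gamma w)
    refine h.congr (Eventually.of_forall fun ξ => ?_)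
    simp only [hfour]
  have hcont : ContinuousAt f 1 := by
    have h1 : f =ᶠ[𝓝 1] fun x : ℝ => (x : ℂ) ^ (w - 1) * Complex.exp (-(c * x)) := by
      filter_upwards [Ioi_mem_nhds one_pos] with x hx
      simp only [hf, indicator_of_mem hx]
    refine ContinuousAt.congr (ContinuousAt.mul ?_ (by fun_prop)) h1.symm
    exact Complex.continuousAt_ofReal_cpow_const _ _ (Or.inr one_ne_zero)
  have hinv := hfi.fourierInv_fourier_eq hFi hcont
  rw [Real.fourierInv_eq'] at hinv
  have hval : f 1 = Complex.exp (-c) := by simp [hf]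
  rw [hval] at hinv
  set g : ℝ → ℂ := fun y =>
    Complex.exp (y * Complex.I) * ((c : ℂ) + y * Complex.I) ^ (-w) with hg
  have hscale : ∫ ξ : ℝ, g (2 * Real.pi * ξ) = Complex.exp (-c) * (Complex.Gamma w)⁻¹ := by
    rw [eq_mul_inv_iff_mul_eq₀ hG, ← hinv, ← integral_mul_const]
    refine integral_congr_ae (Eventually.of_forall fun ξ => ?_)
    simp only [hg, hfour, smul_eq_mul]
    simp
    ring
  rw [Measure.integral_comp_mul_left, abs_inv, abs_of_pos (by positivity), inv_smul_eq_iff₀ hpi,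
    Complex.real_smul] at hscale
  have : ∀ y : ℝ, Complex.exp (c + y * Complex.I) * ((c : ℂ) + y * Complex.I) ^ (-w) =
      Complex.exp c * g y := fun y => by
    simp only [hg, Complex.exp_add]; ring
  simp_rw [this]
  rw [integral_const_mul, hscale, Complex.exp_neg]
  have := Complex.exp_ne_zero c
  field_simp
  push_cast
  ring

/-! ### Hankel's formula on a wedge -/

/-- A bound that absorbs powers and stretched exponentials of exponent `ν < 1` into an
exponential. -/
theorem exists_rpow_mul_exp_rpow_le {δ ν ε : ℝ} (hδ : 0 < δ) (hν1 : ν < 1) (hε : 0 < ε)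
    (p r : ℝ) : ∃ C, 0 ≤ C ∧ ∀ x, δ ≤ x → x ^ p * Real.exp (r * x ^ ν) ≤ C * Real.exp (ε * x) := by
  have hlo : ∀ᶠ x : ℝ in atTop, x ^ p * Real.exp (r * x ^ ν) ≤ 1 * Real.exp (ε * x) := by
    have h1 := (isLittleO_rpow_exp_pos_mul_atTop p (half_pos hε)).bound one_pos
    have h2 : Tendsto (fun x : ℝ => r * x ^ (-(1 - ν))) atTop (𝓝 0) := by
      simpa using (tendsto_rpow_neg_atTop (y := 1 - ν) (by linarith)).const_mul r
    filter_upwards [h1, h2.eventually_lt_const (half_pos hε), eventually_gt_atTop 0]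
      with x hx1 hx2 hx0
    rw [one_mul, Real.norm_of_nonneg (by positivity), Real.norm_of_nonneg (by positivity)] at hx1
    have h3 : r * x ^ ν ≤ ε / 2 * x := by
      have : x ^ ν = x ^ (-(1 - ν)) * x := by
        rw [← Real.rpow_add_one hx0.ne']; congr 1; ring
      rw [this, ← mul_assoc]
      gcongr
    calc x ^ p * Real.exp (r * x ^ ν) ≤ Real.exp (ε / 2 * x) * Real.exp (ε / 2 * x) := by gcongr
      _ = 1 * Real.exp (ε * x) := by rw [← Real.exp_add, one_mul]; congr 1; ring
  obtain ⟨X, hX⟩ := eventually_atTop.1 hlo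
  have hcont : ContinuousOn (fun x : ℝ => x ^ p * Real.exp (r * x ^ ν) / Real.exp (ε * x))
      (Icc δ X) := by
    intro x hx
    have hx0 : x ≠ 0 := (hδ.trans_le hx.1).ne'
    refine ContinuousAt.continuousWithinAt (ContinuousAt.div (ContinuousAt.mul ?_
      (ContinuousAt.rexp (continuousAt_const.mul ?_))) (by fun_prop) (Real.exp_pos _).ne')
    · exact Real.continuousAt_rpow_const _ _ (Or.inl hx0)
    · exact Real.continuousAt_rpow_const _ _ (Or.inl hx0)
  obtain ⟨C, hC⟩ := isCompact_Icc.bddAbove_image hcont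
  refine ⟨max C 1, by positivity, fun x hx => ?_⟩
  rcases le_total x X with h | h
  · have := hC (mem_image_of_mem _ ⟨hx, h⟩)
    rw [div_le_iff₀ (Real.exp_pos _)] at this
    exact this.trans (by gcongr; exact le_max_left _ _)
  · exact (hX x h).trans (by gcongr; exact le_max_right _ _)

theorem exists_exp_rayPoint_mul_le {c η ν : ℝ} (hc : 0 < c) (hη : 0 < η) (hη1 : η < 1)
    (hν1 : ν < 1) (p r : ℝ) : ∃ C, 0 ≤ C ∧ ∀ σ ρ : ℝ, |σ| = 1 → 0 ≤ ρ →
      ‖Complex.exp (rayPoint c σ η ρ)‖ *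
        (‖rayPoint c σ η ρ‖ ^ p * Real.exp (r * ‖rayPoint c σ η ρ‖ ^ ν)) ≤
      C * Real.exp (-(η / 2 * ρ)) := by
  obtain ⟨C, hC0, hC⟩ := exists_rpow_mul_exp_rpow_le (half_pos hc) hν1 (ε := η / 4)
    (by positivity) p r
  -- `‖e ^ t‖ = e ^ (c - η ρ)` and `‖t‖ ≤ c + 2 ρ`, so the rate `η / 4` leaves decay at rate `η / 2`.
  refine ⟨C * Real.exp (c + η / 4 * c), by positivity, fun σ ρ hσ hρ => ?_⟩
  have h1 := hC _ (half_le_norm_rayPoint (η := η) hσ hη1.le hρ)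
  have h2 := norm_rayPoint_le hc hσ hη.le hη1.le hρ
  rw [Complex.norm_exp, rayPoint_re]
  calc _ ≤ Real.exp (c - ρ * η) * (C * Real.exp (η / 4 * (c + 2 * ρ))) := by
        refine mul_le_mul_of_nonneg_left (h1.trans ?_) (Real.exp_pos _).le
        gcongr
    _ = _ := by
        rw [mul_left_comm, ← Real.exp_add, mul_assoc, ← Real.exp_add]
        congr 2; ring

theorem exists_norm_exp_mul_cpow_neg_le {c η : ℝ} (hc : 0 < c) (hη : 0 < η) (hη1 : η < 1) (w : ℂ) :
    ∃ C, 0 ≤ C ∧ ∀ σ ρ : ℝ, |σ| = 1 → 0 ≤ ρ →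
      ‖Complex.exp (rayPoint c σ η ρ) * rayPoint c σ η ρ ^ (-w)‖ ≤ C * Real.exp (-(η / 2 * ρ)) := by
  obtain ⟨C, hC0, hC⟩ := exists_exp_rayPoint_mul_le hc hη hη1 zero_lt_one (-w.re) 0
  refine ⟨Real.exp (Real.pi * |w.im|) * C, by positivity, fun σ ρ hσ hρ => ?_⟩
  have h := hC σ ρ hσ hρ
  rw [zero_mul, Real.exp_zero, mul_one] at h
  rw [norm_mul]
  calc _ ≤ ‖Complex.exp (rayPoint c σ η ρ)‖ *
        (Real.exp (Real.pi * |w.im|) * ‖rayPoint c σ η ρ‖ ^ (-w.re)) := by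
        gcongr; exact norm_cpow_neg_le _ _
    _ = Real.exp (Real.pi * |w.im|) *
        (‖Complex.exp (rayPoint c σ η ρ)‖ * ‖rayPoint c σ η ρ‖ ^ (-w.re)) := by ring
    _ ≤ _ := by rw [mul_assoc]; gcongr

/-- The integral of `e ^ t t ^ (-w)` along the ray from `c` in the direction `σ i - η`. -/
noncomputable def rayIntegral (c σ η : ℝ) (w : ℂ) : ℂ :=
  ∫ ρ in Ioi (0 : ℝ), (σ * Complex.I - η) *
    (Complex.exp (rayPoint c σ η ρ) * rayPoint c σ η ρ ^ (-w))

theorem continuousOn_exp_mul_cpow_rayPoint {c σ η : ℝ} (hc : 0 < c) (hσ : |σ| = 1) (w : ℂ) :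
    ContinuousOn (fun ρ => Complex.exp (rayPoint c σ η ρ) * rayPoint c σ η ρ ^ w) (Ici 0) := by
  refine ((continuous_rayPoint c σ η).cexp.continuousOn).mul ?_
  exact (continuous_rayPoint c σ η).continuousOn.cpow continuousOn_const
    (fun ρ hρ => rayPoint_mem_slitPlane hc hσ hρ)

theorem integrableOn_rayIntegral {c σ η : ℝ} (hc : 0 < c) (hσ : |σ| = 1) (hη : 0 < η)
    (hη1 : η < 1) (w : ℂ) :
    IntegrableOn (fun ρ => Complex.exp (rayPoint c σ η ρ) * rayPoint c σ η ρ ^ (-w)) (Ioi 0) := by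
  obtain ⟨C, -, hC⟩ := exists_norm_exp_mul_cpow_neg_le hc hη hη1 w
  have h : IntegrableOn (fun ρ : ℝ => C * Real.exp (-(η / 2 * ρ))) (Ioi 0) := by
    have := (exp_neg_integrableOn_Ioi 0 (half_pos hη)).const_mul C
    simpa [IntegrableOn] using this
  refine h.mono' (((continuousOn_exp_mul_cpow_rayPoint hc hσ _).mono
    Ioi_subset_Ici_self).aestronglyMeasurable measurableSet_Ioi) ?_
  filter_upwards [ae_restrict_mem measurableSet_Ioi] with ρ hρ
  exact hC σ ρ hσ (le_of_lt hρ)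

theorem hasDerivAt_exp_mul_cpow_neg {t : ℂ} (ht : t ∈ Complex.slitPlane) (w : ℂ) :
    HasDerivAt (fun t : ℂ => Complex.exp t * t ^ (-w))
      (Complex.exp t * t ^ (-w) - w * (Complex.exp t * t ^ (-(w + 1)))) t := by
  have h := (Complex.hasDerivAt_exp t).mul (((hasDerivAt_id t).cpow_const (c := -w)) ht)
  refine h.congr_deriv ?_
  simp only [id, neg_add']
  ring

/-- Integration by parts. The boundary term at the apex `c` does not depend on the direction of
the ray, so that it cancels in a difference of two ray integrals. -/
theorem rayIntegral_sub_mul_rayIntegral_add_one {c σ η : ℝ} (hc : 0 < c) (hσ : |σ| = 1)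
    (hη : 0 < η) (hη1 : η < 1) (w : ℂ) :
    rayIntegral c σ η w - w * rayIntegral c σ η (w + 1) = -(Complex.exp c * (c : ℂ) ^ (-w)) := by
  have h1 := (integrableOn_rayIntegral hc hσ hη hη1 w).const_mul ((σ : ℂ) * Complex.I - η)
  have h2 := ((integrableOn_rayIntegral hc hσ hη hη1 (w + 1)).const_mul
    ((σ : ℂ) * Complex.I - η)).const_mul w
  obtain ⟨C, -, hC⟩ := exists_norm_exp_mul_cpow_neg_le hc hη hη1 w
  rw [rayIntegral, rayIntegral, ← integral_const_mul, ← integral_sub h1 h2]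
  refine (integral_Ioi_of_hasDerivAt_of_tendsto
    (f := fun ρ => Complex.exp (rayPoint c σ η ρ) * rayPoint c σ η ρ ^ (-w)) (m := 0)
    (continuousOn_exp_mul_cpow_rayPoint hc hσ _ 0 self_mem_Ici) (fun ρ hρ => ?_) (h1.sub h2)
    ?_).trans ?_
  · refine ((hasDerivAt_exp_mul_cpow_neg (rayPoint_mem_slitPlane hc hσ (le_of_lt hρ)) w).comp ρ
      (hasDerivAt_rayPoint c σ η ρ)).congr_deriv ?_
    simp only [Pi.sub_apply]
    ring
  · have hlim : Tendsto (fun ρ : ℝ => C * Real.exp (-(η / 2 * ρ))) atTop (𝓝 0) := by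
      have := (Real.tendsto_exp_neg_atTop_nhds_zero.comp
        (tendsto_id.const_mul_atTop (half_pos hη))).const_mul C
      simpa [Function.comp_def] using this
    refine squeeze_zero_norm' ?_ hlim
    filter_upwards [eventually_ge_atTop (0 : ℝ)] with ρ hρ using hC σ ρ hσ hρ
  · simp [rayPoint]

theorem rayIntegral_eq_vertical {c σ η : ℝ} (hc : 0 < c) (hσ : |σ| = 1) (hη : 0 ≤ η)
    (hη1 : η < 1) {w : ℂ} (hw : 2 < w.re) :
    rayIntegral c σ η w = ∫ ρ in Ioi (0 : ℝ), (σ * Complex.I) *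
      (Complex.exp (c + ((σ * ρ : ℝ) : ℂ) * Complex.I) *
        ((c : ℂ) + ((σ * ρ : ℝ) : ℂ) * Complex.I) ^ (-w)) := by
  have hbase : ∀ t ∈ Complex.slitPlane, t.re ≤ c →
      ‖Complex.exp t * t ^ (-w)‖ ≤ Real.exp c * Real.exp (Real.pi * |w.im|) * ‖t‖ ^ (-w.re) := by
    intro t _ htc
    rw [norm_mul, mul_assoc, Complex.norm_exp]
    gcongr
    exact norm_cpow_neg_le _ _
  have hA : 0 ≤ Real.exp c * Real.exp (Real.pi * |w.im|) := by positivity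
  have hB : 0 ≤ ‖w‖ * (2 / c) := by positivity
  rw [rayIntegral, integral_ray_tilt (F := fun t => Complex.exp t * t ^ (-w))
    (F' := fun t => Complex.exp t * t ^ (-w) - w * (Complex.exp t * t ^ (-(w + 1))))
    (p := w.re) (C := Real.exp c * Real.exp (Real.pi * |w.im|) * (1 + ‖w‖ * (2 / c)))
    hc hw hσ hη hη1 (fun t ht => hasDerivAt_exp_mul_cpow_neg ht w)]
  · refine integral_congr_ae (Eventually.of_forall fun ρ => ?_)
    have : rayPoint c σ 0 ρ = c + ((σ * ρ : ℝ) : ℂ) * Complex.I := by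
      simp [rayPoint]; ring
    simp only [this]
  · have hc' : ∀ v : ℂ, ContinuousOn (fun t : ℂ => Complex.exp t * t ^ v) Complex.slitPlane :=
      fun v => Complex.continuous_exp.continuousOn.mul
        (continuousOn_id.cpow continuousOn_const fun t ht => ht)
    exact (hc' _).sub (continuousOn_const.mul (hc' _))
  · intro t ht htc _
    refine (hbase t ht htc).trans ?_
    refine mul_le_mul_of_nonneg_right ?_ (by positivity)
    exact le_mul_of_one_le_right hA (by linarith)
  · intro t ht htc htn
    have ht0 : t ≠ 0 := Complex.slitPlane_ne_zero ht
    have hfac : Complex.exp t * t ^ (-w) - w * (Complex.exp t * t ^ (-(w + 1))) =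
        (Complex.exp t * t ^ (-w)) * (1 - w * t⁻¹) := by
      rw [neg_add, Complex.cpow_add _ _ ht0, Complex.cpow_neg_one]; ring
    have h2 : ‖1 - w * t⁻¹‖ ≤ 1 + ‖w‖ * (2 / c) := by
      refine (norm_sub_le _ _).trans ?_
      rw [norm_one, norm_mul, norm_inv]
      gcongr
      rw [show 2 / c = (c / 2)⁻¹ by rw [inv_div]]
      gcongr
    rw [hfac, norm_mul]
    calc _ ≤ (Real.exp c * Real.exp (Real.pi * |w.im|) * ‖t‖ ^ (-w.re)) *
          (1 + ‖w‖ * (2 / c)) := by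
          gcongr
          exact hbase t ht htc
      _ = _ := by ring

/-- **Hankel's formula** for the reciprocal Gamma function, on the wedge formed by the two rays
from `c > 0` in the directions `± i - η`. -/
theorem rayIntegral_sub_rayIntegral {c η : ℝ} (hc : 0 < c) (hη : 0 < η) (hη1 : η < 1) (w : ℂ) :
    rayIntegral c 1 η w - rayIntegral c (-1) η w =
      2 * Real.pi * Complex.I * (Complex.Gamma w)⁻¹ := by
  have hlarge : ∀ w : ℂ, 2 < w.re → rayIntegral c 1 η w - rayIntegral c (-1) η w =
      2 * Real.pi * Complex.I * (Complex.Gamma w)⁻¹ := by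
    intro w hw
    set g : ℝ → ℂ := fun y =>
      Complex.exp (c + y * Complex.I) * ((c : ℂ) + y * Complex.I) ^ (-w) with hg
    have hgi : Integrable g := by
      refine (integrable_vertical_cpow_neg hc (w := w) (by linarith)).bdd_mul (c := Real.exp c)
        (by fun_prop) (Eventually.of_forall fun y => ?_)
      rw [Complex.norm_exp]; simp
    have hsplit := intervalIntegral.integral_Iic_add_Ioi (b := 0) hgi.integrableOn hgi.integrableOn
    rw [integral_vertical_exp_mul_cpow_neg hc (by linarith), ← neg_zero,
      ← integral_comp_neg_Ioi, neg_zero] at hsplit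
    rw [rayIntegral_eq_vertical hc (by simp) hη.le hη1 hw,
      rayIntegral_eq_vertical hc (by simp) hη.le hη1 hw, integral_const_mul, integral_const_mul]
    simp only [hg] at hsplit
    simp only [one_mul, neg_mul, Complex.ofReal_one, Complex.ofReal_neg, sub_neg_eq_add] at hsplit ⊢
    rw [← mul_add, add_comm, hsplit]
    ring
  -- Both sides satisfy `f w = w * f (w + 1)`, which carries the formula to the left by steps of `1`.
  have hall : ∀ n : ℕ, ∀ w : ℂ, 2 < w.re + n → rayIntegral c 1 η w - rayIntegral c (-1) η w =
      2 * Real.pi * Complex.I * (Complex.Gamma w)⁻¹ := by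
    intro n
    induction n with
    | zero => intro w hw; exact hlarge w (by simpa using hw)
    | succ n ih =>
      intro w hw
      have h := ih (w + 1) (by push_cast at hw; simp; linarith)
      have h1 := rayIntegral_sub_mul_rayIntegral_add_one hc (σ := 1) (by simp) hη hη1 w
      have h2 := rayIntegral_sub_mul_rayIntegral_add_one hc (σ := -1) (by simp) hη hη1 w
      rw [Complex.one_div_Gamma_eq_self_mul_one_div_Gamma_add_one w]
      linear_combination h1 - h2 + w * h
  obtain ⟨n, hn⟩ := exists_nat_gt (2 - w.re)
  exact hall n w (by linarith)

/-! ### The Laplace transform from Hankel's formula -/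

section Hankel

variable {X : Type*} [MeasurableSpace X] {m : Measure X} {ν : ℝ} {k u : X → ℂ}

theorem integrable_mul_cpow_mul_exp (hk : AEStronglyMeasurable k m) (hu : Measurable u)
    (hint : ∀ p r : ℝ, Integrable (fun x => ‖k x‖ * (‖u x‖ ^ p * Real.exp (r * ‖u x‖ ^ ν))) m)
    (w : ℂ) (r : ℝ) :
    Integrable (fun x => ‖k x * u x ^ (-w)‖ * Real.exp (r * ‖u x‖ ^ ν)) m := by
  have hmeas : AEStronglyMeasurable (fun x => k x * u x ^ (-w)) m :=
    hk.mul (hu.pow_const _).aestronglyMeasurable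
  refine ((hint (-w.re) r).const_mul (Real.exp (Real.pi * |w.im|))).mono'
    (hmeas.norm.mul (Measurable.aestronglyMeasurable (by fun_prop)))
    (Eventually.of_forall fun x => ?_)
  rw [Real.norm_of_nonneg (by positivity), norm_mul]
  calc _ ≤ ‖k x‖ * (Real.exp (Real.pi * |w.im|) * ‖u x‖ ^ (-w.re)) *
        Real.exp (r * ‖u x‖ ^ ν) := by
        gcongr; exact norm_cpow_neg_le _ _
    _ = _ := by ring

theorem integrable_mul_cpow (hk : AEStronglyMeasurable k m) (hu : Measurable u)
    (hint : ∀ p r : ℝ, Integrable (fun x => ‖k x‖ * (‖u x‖ ^ p * Real.exp (r * ‖u x‖ ^ ν))) m)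
    (w : ℂ) : Integrable (fun x => k x * u x ^ (-w)) m := by
  have h := integrable_mul_cpow_mul_exp hk hu hint w 0
  simp only [zero_mul, Real.exp_zero, mul_one] at h
  exact (integrable_norm_iff (hk.mul (hu.pow_const _).aestronglyMeasurable)).1 h

/-- Integrating the exponential series of `exp (-r u ^ ν)` against `k u ^ (-μ)` term by term. -/
theorem wright_neg_eq_integral (hk : AEStronglyMeasurable k m) (hu : Measurable u)
    (hu0 : ∀ x, u x ≠ 0)
    (hint : ∀ p r : ℝ, Integrable (fun x => ‖k x‖ * (‖u x‖ ^ p * Real.exp (r * ‖u x‖ ^ ν))) m)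
    (hH : ∀ w : ℂ, ∫ x, k x * u x ^ (-w) ∂m = (Complex.Gamma w)⁻¹) (μ : ℂ) {r : ℝ} (hr : 0 ≤ r) :
    wright (-ν) μ (-(r : ℂ)) =
      ∫ x, k x * u x ^ (-μ) * Complex.exp (-(r * u x ^ (ν : ℂ))) ∂m := by
  have hsumR : ∀ x, HasSum (fun n : ℕ => ‖k x * u x ^ (-μ)‖ *
      ((r * ‖u x‖ ^ ν) ^ n / n.factorial)) (‖k x * u x ^ (-μ)‖ * Real.exp (r * ‖u x‖ ^ ν)) := by
    intro x
    rw [Real.exp_eq_exp_ℝ]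
    exact (NormedSpace.expSeries_div_hasSum_exp (r * ‖u x‖ ^ ν)).mul_left _
  have hnorm : ∀ x, ‖u x ^ (ν : ℂ)‖ = ‖u x‖ ^ ν := fun x => by
    rw [Complex.norm_cpow_of_ne_zero (hu0 x)]; simp
  have hpow : ∀ (n : ℕ) (x : X), u x ^ (-(((-ν : ℝ) : ℂ) * n + μ)) =
      u x ^ (-μ) * (u x ^ (ν : ℂ)) ^ n := by
    intro n x
    rw [← Complex.cpow_mul_nat, ← Complex.cpow_add _ _ (hu0 x)]
    congr 1; push_cast; ring
  have key := hasSum_integral_of_dominated_convergence (μ := m)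
    (F := fun (n : ℕ) x => k x * u x ^ (-μ) * ((-(r * u x ^ (ν : ℂ))) ^ n / n.factorial))
    (f := fun x => k x * u x ^ (-μ) * Complex.exp (-(r * u x ^ (ν : ℂ))))
    (fun n x => ‖k x * u x ^ (-μ)‖ * ((r * ‖u x‖ ^ ν) ^ n / n.factorial))
    (fun n => (hk.mul (hu.pow_const _).aestronglyMeasurable).mul
      (Measurable.aestronglyMeasurable (by fun_prop)))
    (fun n => Eventually.of_forall fun x => by
      rw [norm_mul, norm_div, norm_pow, norm_neg, norm_mul (r : ℂ), hnorm, Complex.norm_real,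
        Real.norm_of_nonneg hr, Complex.norm_natCast])
    (Eventually.of_forall fun x => (hsumR x).summable)
    (by
      simp_rw [fun x => (hsumR x).tsum_eq]
      exact integrable_mul_cpow_mul_exp hk hu hint μ r)
    (Eventually.of_forall fun x => by
      rw [Complex.exp_eq_exp_ℂ]
      exact (NormedSpace.expSeries_div_hasSum_exp (-(r * u x ^ (ν : ℂ)))).mul_left _)
  rw [← key.tsum_eq, wright]
  congr 1
  funext n
  rw [mul_inv, ← hH, ← mul_assoc, ← integral_const_mul]
  refine integral_congr_ae (Eventually.of_forall fun x => ?_)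
  simp only [hpow]
  rw [neg_mul_eq_neg_mul, mul_pow]
  ring

/-- Expanding `1 / (s + u ^ ν)` in powers of `-s / u ^ ν`, which are smaller than a geometric
series because `‖u ^ ν‖ ≥ ‖s‖ + 1`. -/
theorem integral_div_eq_mittagLefflerTwo (hk : AEStronglyMeasurable k m) (hu : Measurable u)
    (hu0 : ∀ x, u x ≠ 0)
    (hint : ∀ p r : ℝ, Integrable (fun x => ‖k x‖ * (‖u x‖ ^ p * Real.exp (r * ‖u x‖ ^ ν))) m)
    (hH : ∀ w : ℂ, ∫ x, k x * u x ^ (-w) ∂m = (Complex.Gamma w)⁻¹) (μ : ℂ) {s : ℂ}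
    (hus : ∀ x, ‖s‖ + 1 ≤ (u x ^ (ν : ℂ)).re) :
    ∫ x, k x * u x ^ (-μ) * (s + u x ^ (ν : ℂ))⁻¹ ∂m = mittagLefflerTwo ν (μ + ν) (-s) := by
  have hq0 : 0 ≤ ‖s‖ / (‖s‖ + 1) := by positivity
  have hq1 : ‖s‖ / (‖s‖ + 1) < 1 := by rw [div_lt_one (by positivity)]; linarith
  have hv0 : ∀ x, u x ^ (ν : ℂ) ≠ 0 := fun x => by
    rw [Complex.cpow_ne_zero_iff]; exact Or.inl (hu0 x)
  have hlow : ∀ x, ‖s‖ + 1 ≤ ‖u x ^ (ν : ℂ)‖ := fun x => (hus x).trans (Complex.re_le_norm _)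
  have hratio : ∀ x, ‖-s * (u x ^ (ν : ℂ))⁻¹‖ ≤ ‖s‖ / (‖s‖ + 1) := fun x => by
    rw [norm_mul, norm_neg, norm_inv, div_eq_mul_inv]
    have := hlow x
    gcongr
  have hi := integrable_mul_cpow hk hu hint (μ + ν)
  have hmeas := hi.aestronglyMeasurable
  have key := hasSum_integral_of_dominated_convergence (μ := m)
    (F := fun (n : ℕ) x => k x * u x ^ (-(μ + ν)) * (-s * (u x ^ (ν : ℂ))⁻¹) ^ n)
    (f := fun x => k x * u x ^ (-(μ + ν)) * (1 - -s * (u x ^ (ν : ℂ))⁻¹)⁻¹)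
    (fun n x => ‖k x * u x ^ (-(μ + ν))‖ * (‖s‖ / (‖s‖ + 1)) ^ n)
    (fun n => hmeas.mul (Measurable.aestronglyMeasurable (by fun_prop)))
    (fun n => Eventually.of_forall fun x => by
      rw [norm_mul, norm_pow]
      have := hratio x
      gcongr)
    (Eventually.of_forall fun x => (summable_geometric_of_lt_one hq0 hq1).mul_left _)
    (by
      simp_rw [tsum_mul_left]
      exact hi.norm.mul_const _)
    (Eventually.of_forall fun x =>
      (hasSum_geometric_of_norm_lt_one ((hratio x).trans_lt hq1)).mul_left _)
  have hleft : ∀ x, k x * u x ^ (-μ) * (s + u x ^ (ν : ℂ))⁻¹ =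
      k x * u x ^ (-(μ + ν)) * (1 - -s * (u x ^ (ν : ℂ))⁻¹)⁻¹ := by
    intro x
    have h1 : u x ^ (-(μ + ν)) = u x ^ (-μ) * (u x ^ (ν : ℂ))⁻¹ := by
      rw [neg_add, Complex.cpow_add _ _ (hu0 x), Complex.cpow_neg _ (ν : ℂ)]
    have h2 : 1 - -s * (u x ^ (ν : ℂ))⁻¹ = (s + u x ^ (ν : ℂ)) * (u x ^ (ν : ℂ))⁻¹ := by
      rw [add_mul, mul_inv_cancel₀ (hv0 x)]; ring
    rw [h1, h2, mul_inv, inv_inv]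
    have := hv0 x
    field_simp
  simp_rw [hleft]
  rw [← key.tsum_eq, mittagLefflerTwo]
  congr 1
  funext n
  rw [← hH, ← integral_const_mul]
  refine integral_congr_ae (Eventually.of_forall fun x => ?_)
  have h3 : u x ^ (-((ν : ℂ) * n + (μ + ν))) =
      u x ^ (-(μ + ν)) * ((u x ^ (ν : ℂ))⁻¹) ^ n := by
    rw [← Complex.cpow_neg, ← Complex.cpow_mul_nat, ← Complex.cpow_add _ _ (hu0 x)]
    congr 1; ring
  simp only [h3, mul_pow]
  ring

/-- If `1 / Γ(w) = ∫ k u ^ (-w)` for every `w`, and if `Re (u ^ ν) ≥ ‖s‖ + 1`, then Fubini's theorem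
gives the Laplace transform at `s` of the Wright function. -/
theorem hasLaplaceAt_wright [SFinite m] (hk : AEStronglyMeasurable k m) (hu : Measurable u)
    (hu0 : ∀ x, u x ≠ 0)
    (hint : ∀ p r : ℝ, Integrable (fun x => ‖k x‖ * (‖u x‖ ^ p * Real.exp (r * ‖u x‖ ^ ν))) m)
    (hH : ∀ w : ℂ, ∫ x, k x * u x ^ (-w) ∂m = (Complex.Gamma w)⁻¹) (μ : ℂ) {s : ℂ}
    (hus : ∀ x, ‖s‖ + 1 ≤ (u x ^ (ν : ℂ)).re) :
    HasLaplaceAt (fun r : ℝ => wright (-ν) μ (-(r : ℂ))) s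
      (mittagLefflerTwo ν (μ + ν) (-s)) := by
  set G : ℝ → X → ℂ := fun r x =>
    k x * u x ^ (-μ) * Complex.exp (-(s + u x ^ (ν : ℂ)) * r) with hG
  have hre : ∀ x, 1 ≤ (s + u x ^ (ν : ℂ)).re := fun x => by
    have h1 := hus x
    have h2 := (abs_le.1 (Complex.abs_re_le_norm s)).1
    rw [Complex.add_re]; linarith
  have hi := integrable_mul_cpow hk hu hint μ
  -- `‖G r x‖ ≤ e ^ (-r) ‖k u ^ (-μ)‖`.
  have hprod : Integrable (Function.uncurry G) ((volume.restrict (Ioi (0 : ℝ))).prod m) := by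
    have hexp : Integrable (fun r : ℝ => Real.exp (-r)) (volume.restrict (Ioi (0 : ℝ))) := by
      simpa [IntegrableOn] using exp_neg_integrableOn_Ioi 0 one_pos
    refine (hexp.mul_prod hi.norm).mono' ?_ ?_
    · exact (hi.aestronglyMeasurable.comp_snd).mul
        (Measurable.aestronglyMeasurable (by fun_prop))
    · have : ∀ᵐ z ∂((volume.restrict (Ioi (0 : ℝ))).prod m), z.1 ∈ Ioi (0 : ℝ) :=
        Measure.quasiMeasurePreserving_fst.ae (ae_restrict_mem measurableSet_Ioi)
      filter_upwards [this] with z hz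
      have hz0 : 0 < z.1 := hz
      simp only [Function.uncurry, hG]
      rw [norm_mul, mul_comm, Complex.norm_exp]
      gcongr
      have : (-(s + u z.2 ^ (ν : ℂ)) * (z.1 : ℂ)).re = -((s + u z.2 ^ (ν : ℂ)).re * z.1) := by
        simp [Complex.mul_re]; ring
      rw [this]
      nlinarith [hre z.2]
  have heq : ∀ r ∈ Ioi (0 : ℝ), Complex.exp (-s * r) * wright (-ν) μ (-(r : ℂ)) =
      ∫ x, G r x ∂m := by
    intro r hr
    rw [wright_neg_eq_integral hk hu hu0 hint hH μ (le_of_lt hr), ← integral_const_mul]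
    refine integral_congr_ae (Eventually.of_forall fun x => ?_)
    simp only [hG]
    rw [mul_left_comm, ← Complex.exp_add]
    congr 2; ring
  refine ⟨?_, ?_⟩
  · exact IntegrableOn.congr_fun (f := fun r => ∫ x, G r x ∂m) hprod.integral_prod_left
      (fun r hr => (heq r hr).symm) measurableSet_Ioi
  · rw [setIntegral_congr_fun measurableSet_Ioi heq, integral_integral_swap hprod,
      ← integral_div_eq_mittagLefflerTwo hk hu hu0 hint hH μ hus]
    refine integral_congr_ae (Eventually.of_forall fun x => ?_)
    simp only [hG]
    rw [integral_const_mul, integral_exp_mul_complex_Ioi]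
    · rw [Complex.ofReal_zero, mul_zero, Complex.exp_zero, neg_div_neg_eq, one_div]
    · have := hre x
      rw [Complex.neg_re]; linarith

end Hankel

/-! ### The wedge -/

/-- The sign which selects the upper ray for `y > 0` and the lower ray for `y ≤ 0`. -/
noncomputable def raySign (y : ℝ) : ℝ := if 0 < y then 1 else -1

theorem abs_raySign (y : ℝ) : |raySign y| = 1 := by
  unfold raySign; split_ifs <;> simp

theorem measurable_raySign : Measurable raySign :=
  Measurable.ite measurableSet_Ioi measurable_const measurable_const

/-- The wedge `t(y) = c - η |y| + i y`, traversed upwards. -/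
noncomputable def wedge (c η y : ℝ) : ℂ := rayPoint c (raySign y) η |y|

/-- The density `t'(y) e ^ t(y) / (2 π i)` on the parameter line of the wedge `t`. -/
noncomputable def wedgeDensity (c η y : ℝ) : ℂ :=
  (2 * Real.pi * Complex.I)⁻¹ * raySign y * (raySign y * Complex.I - η) * Complex.exp (wedge c η y)

theorem measurable_wedge (c η : ℝ) : Measurable (wedge c η) := by
  have := measurable_raySign
  unfold wedge rayPoint
  fun_prop

theorem measurable_wedgeDensity (c η : ℝ) : Measurable (wedgeDensity c η) := by
  have := measurable_raySign
  have := measurable_wedge c η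
  unfold wedgeDensity
  fun_prop

theorem integrable_wedgeDensity_mul {c η ν : ℝ} (hc : 0 < c) (hη : 0 < η) (hη1 : η < 1)
    (hν1 : ν < 1) (p r : ℝ) :
    Integrable (fun y => ‖wedgeDensity c η y‖ *
      (‖wedge c η y‖ ^ p * Real.exp (r * ‖wedge c η y‖ ^ ν))) := by
  obtain ⟨C, hC0, hC⟩ := exists_exp_rayPoint_mul_le hc hη hη1 hν1 p r
  have hexp : Integrable (fun y : ℝ => Real.exp (-(η / 2 * |y|))) := by
    rw [← integrableOn_univ, ← Iic_union_Ioi (a := (0 : ℝ)), integrableOn_union]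
    refine ⟨(integrableOn_exp_mul_Iic (half_pos hη) 0).congr_fun (fun y hy => ?_)
      measurableSet_Iic, (integrableOn_exp_mul_Ioi (neg_lt_zero.2 (half_pos hη)) 0).congr_fun
      (fun y hy => ?_) measurableSet_Ioi⟩
    · simp only [abs_of_nonpos (mem_Iic.1 hy), mul_neg, neg_neg]
    · simp only [abs_of_pos (mem_Ioi.1 hy), neg_mul]
  have := measurable_wedge c η
  have := measurable_wedgeDensity c η
  refine (hexp.const_mul ((2 * Real.pi)⁻¹ * 2 * C)).mono'
    (Measurable.aestronglyMeasurable (by fun_prop)) (Eventually.of_forall fun y => ?_)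
  rw [Real.norm_of_nonneg (by positivity)]
  have h1 : ‖(raySign y : ℂ) * Complex.I - η‖ ≤ 2 := by
    refine (norm_sub_le _ _).trans ?_
    simp only [norm_mul, Complex.norm_real, Complex.norm_I, Real.norm_eq_abs, abs_raySign,
      abs_of_pos hη]
    linarith
  have h2 : ‖wedgeDensity c η y‖ ≤ (2 * Real.pi)⁻¹ * 2 * ‖Complex.exp (wedge c η y)‖ := by
    unfold wedgeDensity
    rw [norm_mul, norm_mul, norm_mul, norm_inv, Complex.norm_real, Real.norm_eq_abs, abs_raySign,
      mul_one]
    have : ‖(2 * Real.pi * Complex.I : ℂ)‖ = 2 * Real.pi := by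
      simp [abs_of_pos Real.pi_pos]
    rw [this]
    gcongr
  have h3 := hC (raySign y) |y| (abs_raySign y) (abs_nonneg y)
  calc _ ≤ (2 * Real.pi)⁻¹ * 2 * ‖Complex.exp (wedge c η y)‖ *
        (‖wedge c η y‖ ^ p * Real.exp (r * ‖wedge c η y‖ ^ ν)) := by gcongr
    _ = (2 * Real.pi)⁻¹ * 2 * (‖Complex.exp (wedge c η y)‖ *
        (‖wedge c η y‖ ^ p * Real.exp (r * ‖wedge c η y‖ ^ ν))) := by ring
    _ ≤ (2 * Real.pi)⁻¹ * 2 * (C * Real.exp (-(η / 2 * |y|))) := by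
        exact mul_le_mul_of_nonneg_left h3 (by positivity)
    _ = _ := by ring

theorem wedge_mem_slitPlane {c η : ℝ} (hc : 0 < c) (y : ℝ) : wedge c η y ∈ Complex.slitPlane :=
  rayPoint_mem_slitPlane hc (abs_raySign y) (abs_nonneg y)

theorem integral_wedgeDensity_mul_cpow_neg {c η : ℝ} (hc : 0 < c) (hη : 0 < η) (hη1 : η < 1)
    (w : ℂ) : ∫ y, wedgeDensity c η y * wedge c η y ^ (-w) = (Complex.Gamma w)⁻¹ := by
  have hi : Integrable (fun y => wedgeDensity c η y * wedge c η y ^ (-w)) :=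
    integrable_mul_cpow (measurable_wedgeDensity c η).aestronglyMeasurable (measurable_wedge c η)
      (integrable_wedgeDensity_mul hc hη hη1 zero_lt_one) w
  have hup : ∫ y in Ioi (0 : ℝ), wedgeDensity c η y * wedge c η y ^ (-w) =
      (2 * Real.pi * Complex.I)⁻¹ * rayIntegral c 1 η w := by
    rw [rayIntegral, ← integral_const_mul]
    refine setIntegral_congr_fun measurableSet_Ioi fun y hy => ?_
    have hy0 : 0 < y := hy
    simp only [wedgeDensity, wedge, raySign, if_pos hy0, abs_of_pos hy0]
    push_cast; ring
  have hdown : ∫ y in Iic (0 : ℝ), wedgeDensity c η y * wedge c η y ^ (-w) =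
      -((2 * Real.pi * Complex.I)⁻¹ * rayIntegral c (-1) η w) := by
    have h := integral_comp_neg_Ioi 0 (fun y => wedgeDensity c η y * wedge c η y ^ (-w))
    rw [neg_zero] at h
    rw [← h, rayIntegral, ← integral_const_mul,
      ← integral_neg]
    refine setIntegral_congr_fun measurableSet_Ioi fun y hy => ?_
    have hy0 : 0 < y := hy
    simp only [wedgeDensity, wedge, raySign, if_neg (not_lt.2 (neg_nonpos.2 hy0.le)), abs_neg,
      abs_of_pos hy0]
    push_cast; ring
  rw [← intervalIntegral.integral_Iic_add_Ioi (b := 0) hi.integrableOn hi.integrableOn, hup, hdown,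
    neg_add_eq_sub, ← mul_sub, rayIntegral_sub_rayIntegral hc hη hη1,
    inv_mul_cancel_left₀ Complex.two_pi_I_ne_zero]

/-- On the wedge with `η = -cos φ` the argument is at most `φ` in absolute value. If moreover
`ν φ < π / 2`, then `Re (t ^ ν) ≥ cos (ν φ) ‖t‖ ^ ν`, which is large when `c` is. -/
theorem cos_mul_rpow_le_re_wedge_cpow {c φ ν : ℝ} (hc : 0 < c) (hν0 : 0 < ν)
    (hφ0 : Real.pi / 2 < φ) (hφ1 : φ < Real.pi) (hφν : ν * φ < Real.pi / 2) (y : ℝ) :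
    Real.cos (ν * φ) * (c / 2) ^ ν ≤ (wedge c (-Real.cos φ) y ^ (ν : ℂ)).re := by
  set t := wedge c (-Real.cos φ) y with ht
  have ht0 : t ≠ 0 := Complex.slitPlane_ne_zero (wedge_mem_slitPlane hc y)
  have hpi := Real.pi_pos
  have hcos : Real.cos φ < 0 := Real.cos_neg_of_pi_div_two_lt_of_lt hφ0 (by linarith)
  have hnorm : c / 2 ≤ ‖t‖ :=
    half_le_norm_rayPoint (abs_raySign y) (by linarith [Real.neg_one_le_cos φ]) (abs_nonneg y)
  have harg : |t.arg| ≤ φ := by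
    -- Otherwise `Re t < ‖t‖ cos φ ≤ |y| cos φ`, whereas `Re t = c + |y| cos φ`.
    by_contra! h
    have h1 : Real.cos |t.arg| < Real.cos φ :=
      Real.cos_lt_cos_of_nonneg_of_le_pi (by linarith) (Complex.abs_arg_le_pi t) h
    rw [Real.cos_abs, Complex.cos_arg ht0, div_lt_iff₀ (norm_pos_iff.2 ht0)] at h1
    have h2 : |y| ≤ ‖t‖ := le_norm_rayPoint (abs_raySign y) (abs_nonneg y)
    have h3 : t.re = c + |y| * Real.cos φ := by
      rw [ht, wedge, rayPoint_re]; ring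
    nlinarith
  have hcosν : Real.cos (ν * φ) ≤ Real.cos (t.arg * ν) := by
    rw [← Real.cos_abs (t.arg * ν), abs_mul, abs_of_pos hν0, mul_comm]
    refine Real.cos_le_cos_of_nonneg_of_le_pi (by positivity) (by linarith) ?_
    exact mul_le_mul_of_nonneg_right harg hν0.le
  rw [Complex.cpow_ofReal_re, mul_comm]
  have : 0 ≤ Real.cos (ν * φ) :=
    (Real.cos_pos_of_mem_Ioo ⟨by nlinarith, hφν⟩).le
  gcongr

end WrightLaplace

theorem mainTheorem3 (ν : ℝ) (hν0 : 0 < ν) (hν1 : ν < 1) :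
    (∀ μ : ℂ, 0 < μ.re → ∀ s : ℂ,
      WrightLaplace.HasLaplaceAt (fun r : ℝ => WrightLaplace.wright (-ν) μ (-(r : ℂ))) s
        (WrightLaplace.mittagLefflerTwo (ν : ℂ) (μ + (ν : ℂ)) (-s))) ∧
    (∀ s : ℂ,
      WrightLaplace.HasLaplaceAt (fun r : ℝ => WrightLaplace.mWright ν (r : ℂ)) s
        (WrightLaplace.mittagLeffler (ν : ℂ) (-s))) := by
  have hpi := Real.pi_pos
  have main : ∀ μ s : ℂ,
      WrightLaplace.HasLaplaceAt (fun r : ℝ => WrightLaplace.wright (-ν) μ (-(r : ℂ))) s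
        (WrightLaplace.mittagLefflerTwo (ν : ℂ) (μ + (ν : ℂ)) (-s)) := by
    intro μ s
    -- A direction to the left of the vertical whose `ν`-th power still points to the right.
    obtain ⟨φ, hφ0, hφ⟩ : ∃ φ, Real.pi / 2 < φ ∧ φ < min Real.pi (Real.pi / 2 / ν) := by
      refine exists_between (lt_min (by linarith) ?_)
      rw [lt_div_iff₀ hν0]
      nlinarith
    have hφ1 : φ < Real.pi := hφ.trans_le (min_le_left _ _)
    have hφν : ν * φ < Real.pi / 2 := by
      have := hφ.trans_le (min_le_right _ _)
      rwa [lt_div_iff₀ hν0, mul_comm] at this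
    have hη0 : 0 < -Real.cos φ :=
      neg_pos.2 (Real.cos_neg_of_pi_div_two_lt_of_lt hφ0 (by linarith))
    have hη1 : -Real.cos φ < 1 := by
      have := Real.cos_lt_cos_of_nonneg_of_le_pi (by linarith) le_rfl hφ1
      rw [Real.cos_pi] at this
      linarith
    have hκ : 0 < Real.cos (ν * φ) := Real.cos_pos_of_mem_Ioo ⟨by nlinarith, hφν⟩
    -- The apex is chosen so far to the right that `Re (t ^ ν) ≥ ‖s‖ + 1` on the whole wedge.
    obtain ⟨c, hc, hcs⟩ : ∃ c : ℝ, 0 < c ∧ ‖s‖ + 1 ≤ Real.cos (ν * φ) * (c / 2) ^ ν := by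
      refine ⟨2 * ((‖s‖ + 1) / Real.cos (ν * φ)) ^ ν⁻¹, by positivity, le_of_eq ?_⟩
      rw [mul_div_cancel_left₀ _ two_ne_zero, Real.rpow_inv_rpow (by positivity) hν0.ne',
        mul_div_cancel₀ _ hκ.ne']
    exact WrightLaplace.hasLaplaceAt_wright
      (WrightLaplace.measurable_wedgeDensity c (-Real.cos φ)).aestronglyMeasurable
      (WrightLaplace.measurable_wedge c (-Real.cos φ))
      (fun y => Complex.slitPlane_ne_zero (WrightLaplace.wedge_mem_slitPlane hc y))
      (WrightLaplace.integrable_wedgeDensity_mul hc hη0 hη1 hν1)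
      (WrightLaplace.integral_wedgeDensity_mul_cpow_neg hc hη0 hη1) μ
      (fun y => hcs.trans
        (WrightLaplace.cos_mul_rpow_le_re_wedge_cpow hc hν0 hφ0 hφ1 hφν y))
  refine ⟨fun μ _ s => main μ s, fun s => ?_⟩
  have h := main (1 - ν) s
  have hE : WrightLaplace.mittagLefflerTwo (ν : ℂ) (1 - ν + ν) (-s) =
      WrightLaplace.mittagLeffler (ν : ℂ) (-s) := by
    simp [WrightLaplace.mittagLefflerTwo, WrightLaplace.mittagLeffler]
  rwa [hE] at h
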